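/- Let $\mathbb{F}$ be a field of characteristic zero. If $A$ is an abelian group, $(\cdot,\cdot):A\times A\to\mathbb{F}$ a map and $R\subseteq A$, write $R_{re}^\times:=\{\alpha\in R\mid(\alpha,\alpha)\neq0\}$, $R_{re}:=R_{re}^\times\cup\{0\}$, $R_{ns}:=\{\alpha\in R\mid(\alpha,\alpha)=0\}$ and $A^0:=\{a\in A\mid(a,b)=0\ \text{for all } b\in A\}$. A *locally finite root supersystem* is a triple $(\mathcal{V},(\cdot,\cdot),R)$, where $\mathcal{V}$ is an $\mathbb{F}$-vector space, $(\cdot,\cdot)$ is a symmetric $\mathbb{F}$-bilinear form $\mathcal{V}\times\mathcal{V}\to\mathbb{F}$ with $\mathcal{V}^0=\{0\}$, and $R\subseteq\mathcal{V}$ is such that: $0\in R$; every finite-dimensional subspace of $\operatorname{span}_{\mathbb{F}}R_{re}$ meets $R_{re}$ in a finite set; $R=-R$; $\operatorname{span}_{\mathbb{F}}R=\mathcal{V}$; for $\alpha\in R_{re}^\times$ and $\beta\in R$, $2(\beta,\alpha)/(\alpha,\alpha)\in\mathbb{Z}$ and $\beta-\frac{2(\beta,\alpha)}{(\alpha,\alpha)}\alpha\in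 R$; for $\alpha\in R_{ns}$ and $\beta\in R$ with $(\alpha,\beta)\neq0$, $\{\beta-\alpha,\beta+\alpha\}\cap R\neq\emptyset$. For an abelian group $A$, a map $(\cdot,\cdot):A\times A\to\mathbb{F}$ and $R\subseteq A$, consider the following conditions. - (S1) $0\in R$ and $\operatorname{span}_{\mathbb{Z}}R=A$. - (S2) $R=-R$. - (S3) For $\alpha\in R_{re}^\times$ and $\beta\in R$, $2(\alpha,\beta)/(\alpha,\alpha)\in\mathbb{Z}$ and $\beta-\frac{2(\beta,\alpha)}{(\alpha,\alpha)}\alpha\in R$. - (S4) For $\alpha,\beta\in R_{re}^\times$ there are nonnegative integers $p,q$ with $2(\beta,\alpha)/(\alpha,\alpha)=p-q$ and $\{\beta+k\alpha\mid k\in\mathbb{Z}\}\cap R_{re}=\{\beta-p\alpha,\dots,\beta+q\alpha\}$. - (S5) For $\alpha\in R_{ns}$ and $\beta\in R$ with $(\alpha,\beta)\neq0$, $\{\beta-\alpha,\beta+\alpha\}\cap R\neq\emptyset$. **Lemma.** (a) Let $A$ be an abelian group with a symmetric biadditive map $(\cdot,\cdot):A\times A\to\mathbb{F}$ such that $A^0=\{0\}$,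 and let $R\subseteq A$ satisfy (S1)–(S5). Then $A$ is torsion-free. Moreover, if $(\cdot,\cdot)_{\mathbb{F}}$ is the $\mathbb{F}$-bilinear form on $\mathbb{F}\otimes_{\mathbb{Z}}A$ given by $(r\otimes a,s\otimes b)_{\mathbb{F}}=rs(a,b)$ for $r,s\in\mathbb{F}$, $a,b\in A$, and $1\otimes R:=\{1\otimes\alpha\mid\alpha\in R\}$, then $(\mathbb{F}\otimes_{\mathbb{Z}}A,(\cdot,\cdot)_{\mathbb{F}},1\otimes R)$ is a locally finite root supersystem. (b) Conversely, let $(\mathcal{V},(\cdot,\cdot),R)$ be a locally finite root supersystem and let $A:=\operatorname{span}_{\mathbb{Z}}R\subseteq\mathcal{V}$. Then $A$ is torsion-free, the restriction $(\cdot,\cdot)|_{A\times A}$ is a symmetric biadditive map with $A^0=\{0\}$, and $(A,(\cdot,\cdot)|_{A\times A},R)$ satisfies (S1)–(S5). -/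

import Mathlib

open scoped TensorProduct

namespace RootSuper

section Sets

variable {A F : Type*} [AddCommGroup A] [Field F]

/-- `f : A × A → F` is a group bi-homomorphism. -/
def IsBiadditive (f : A → A → F) : Prop :=
  (∀ a b c, f (a + b) c = f a c + f b c) ∧ (∀ a b c, f a (b + c) = f a b + f a c)

/-- The form `f` is symmetric. -/
def IsSymmetric (f : A → A → F) : Prop := ∀ a b, f a b = f b a

/-- The radical `A⁰ = {a | (a, b) = 0 for all b}`. -/
def radical (f : A → A → F) : Set A := {a | ∀ b, f a b = 0}

/-- `R_re^× = {α ∈ R | (α, α) ≠ 0}`. -/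
def nzRealRoots (f : A → A → F) (R : Set A) : Set A := {α | α ∈ R ∧ f α α ≠ 0}

/-- `R_re = R_re^× ∪ {0}`. -/
def realRoots (f : A → A → F) (R : Set A) : Set A := nzRealRoots f R ∪ {0}

/-- `R_ns = {α ∈ R | (α, α) = 0}`. -/
def nsRoots (f : A → A → F) (R : Set A) : Set A := {α | α ∈ R ∧ f α α = 0}

/-- The five axioms for a root supersystem as a subset `R` of an abelian group `A` with an
`F`-valued form `f`. -/
structure SatisfiesS (f : A → A → F) (R : Set A) : Prop where
  /-- `0 ∈ R` and `span_ℤ R = A` -/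
  s1 : (0 : A) ∈ R ∧ AddSubgroup.closure R = ⊤
  /-- `R = -R` -/
  s2 : R = {a | -a ∈ R}
  /-- the number `2(α, β)/(α, α)` is an integer `n`, and `β - n α ∈ R` -/
  s3 : ∀ α ∈ nzRealRoots f R, ∀ β ∈ R,
    ∃ n : ℤ, 2 * f α β / f α α = (n : F) ∧ β - n • α ∈ R
  /-- for real `α, β ≠ 0` the `α`-string through `β` in `R_re` is `{β - p α, …, β + q α}` with
  `p - q = 2(β, α)/(α, α)` -/
  s4 : ∀ α ∈ nzRealRoots f R, ∀ β ∈ nzRealRoots f R,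
    ∃ p q : ℕ, 2 * f β α / f α α = (p : F) - (q : F) ∧
      {x | ∃ k : ℤ, x = β + k • α} ∩ realRoots f R =
        {x | ∃ k : ℤ, -(p : ℤ) ≤ k ∧ k ≤ (q : ℤ) ∧ x = β + k • α}
  /-- if `α` is isotropic and `(α, β) ≠ 0`, then `β - α` or `β + α` lies in `R` -/
  s5 : ∀ α ∈ nsRoots f R, ∀ β ∈ R, f α β ≠ 0 → β - α ∈ R ∨ β + α ∈ R

end Sets

section Supersystem

variable {F V : Type*} [Field F] [AddCommGroup V] [Module F V]

/-- `(V, B, R)` is a locally finite root supersystem over `F`. -/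
structure IsLocallyFiniteRootSupersystem
    (B : LinearMap.BilinForm F V) (R : Set V) : Prop where
  /-- the form is symmetric -/
  symm : IsSymmetric (fun u v => B u v)
  /-- the form is nondegenerate -/
  nondegenerate : radical (fun u v => B u v) = {0}
  zero_mem : (0 : V) ∈ R
  /-- `R_re` is locally finite in `V_re = span_F R_re`: it meets every finite dimensional subspace
  of `V_re` in a finite set -/
  locallyFinite : ∀ W : Submodule F V,
    W ≤ Submodule.span F (realRoots (fun u v => B u v) R) → FiniteDimensional F W →
      ((W : Set V) ∩ realRoots (fun u v => B u v) R).Finite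
  /-- `R = -R` -/
  neg_eq : R = {v | -v ∈ R}
  span_eq_top : Submodule.span F R = ⊤
  reflection : ∀ α ∈ nzRealRoots (fun u v => B u v) R, ∀ β ∈ R,
    (∃ n : ℤ, 2 * B β α / B α α = (n : F)) ∧ β - (2 * B β α / B α α) • α ∈ R
  nonsingular : ∀ α ∈ nsRoots (fun u v => B u v) R, ∀ β ∈ R,
    B α β ≠ 0 → β - α ∈ R ∨ β + α ∈ R

end Supersystem

section Extension

variable {A F : Type*} [AddCommGroup A] [Field F]

/-- A group bi-homomorphism, bundled as a `ℤ`-bilinear map. -/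
def toIntBilin (f : A → A → F) (hf : IsBiadditive f) : A →ₗ[ℤ] A →ₗ[ℤ] F :=
  (AddMonoidHom.mk' (fun a => (AddMonoidHom.mk' (f a) (hf.2 a)).toIntLinearMap)
    (fun a b => LinearMap.ext (fun c => hf.1 a b c))).toIntLinearMap

/-- The `F`-bilinear extension of `f` to `F ⊗_ℤ A`. -/
noncomputable def extendForm (f : A → A → F) (hf : IsBiadditive f) :
    LinearMap.BilinForm F (F ⊗[ℤ] A) :=
  LinearMap.liftBaseChange F
    (((LinearMap.liftBaseChangeEquiv F).toLinearMap.restrictScalars ℤ) ∘ₗ toIntBilin f hf)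

/-- The extension is the one with `(r ⊗ a, s ⊗ b)_F = r s (a, b)`. -/
theorem extendForm_tmul (f : A → A → F) (hf : IsBiadditive f) (r s : F) (a b : A) :
    extendForm f hf (r ⊗ₜ[ℤ] a) (s ⊗ₜ[ℤ] b) = r * s * f a b := by
  simp [extendForm, toIntBilin, mul_assoc]

end Extension

end RootSuper

/-!
Both directions come down to the combinatorics of real roots, encoded by the Cartan integers
`2(β, α)/(α, α)`.

From an abelian group `A` to `F ⊗ A`. The string axiom puts `β - α` among the real roots and `0`
when the Cartan integer is positive, and integrality for the new root then rules out Cartan integers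
of opposite sign and those of absolute value above `4`. Two real roots with the
same values against all real roots differ by an isotropic vector of a root string, which must be
`0`. On a finite dimensional subspace finitely many of these values determine the others, each takes
finitely many values, and local finiteness follows (`SatisfiesS.finite_setOf_one_tmul_mem`).

The remaining point is that the form stays nondegenerate over `F`, although its values need not be
rational. Local finiteness makes the relevant reflection groups finite, and averaging over one of
them shows that the span `W` of the real roots meets its orthogonal complement `N` trivially
(`SatisfiesS.eq_zero_of_mem_closure_real`). For an isotropic root `δ`, the group `A` is the sum of a
subgroup generated by roots that are multiples of `δ` modulo `W` and of a subgroup orthogonal both to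
it and to `δ`; hence `(·, δ)` takes values in a rank one group on `N`
(`SatisfiesS.exists_int_mul_form_eq`). Now write an element of the radical of `F ⊗ A` as
`∑ eᵢ ⊗ aᵢ` with `eᵢ` linearly independent over `ℤ`. Integrality of coroots puts every `aᵢ` in `N`,
the rank one property makes every `aᵢ` orthogonal to the isotropic roots, and nondegeneracy on `A`
gives `aᵢ = 0`.

From a root supersystem to the lattice of its roots. Only the string axiom needs an argument. The
span of two real roots contains finitely many real roots, which bounds the product of the Cartan
integers by `4` (`IsLocallyFiniteRootSupersystem.mul_isCartanInt_mem_Icc`) and shows that `β - α` is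
real or `0` whenever the Cartan integer is positive. So strings are finite, symmetric, and closed
under steps towards their centre, which makes them unbroken.
-/

namespace RootSuper

/-! ### Arithmetic of forms and Cartan integers -/

section CartanIntegers

variable {A F : Type*} [Field F] {f : A → A → F}

/-- `IsCartanInt f β α m` says that `m = 2(β, α)/(α, α)`, with the denominator cleared. -/
def IsCartanInt (f : A → A → F) (β α : A) (m : ℤ) : Prop := 2 * f β α = m * f α α

namespace IsCartanInt

variable {α β : A} {m n : ℤ}

theorem unique [CharZero F] (hα : f α α ≠ 0) (hm : IsCartanInt f β α m)
    (hn : IsCartanInt f β α n) : m = n := by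
  have := mul_right_cancel₀ hα (hm.symm.trans hn)
  exact_mod_cast this

theorem self (α : A) : IsCartanInt f α α 2 := by simp [IsCartanInt]

theorem eq_zero_iff [CharZero F] (hs : f α β = f β α) (hα : f α α ≠ 0) (hβ : f β β ≠ 0)
    (hm : IsCartanInt f β α m) (hn : IsCartanInt f α β n) : m = 0 ↔ n = 0 := by
  unfold IsCartanInt at *
  rw [hs] at hn
  have h : (m : F) * f α α = n * f β β := hm.symm.trans hn
  constructor
  · rintro rfl
    simpa [hβ] using h.symm
  · rintro rfl
    simpa [hα] using h

end IsCartanInt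

end CartanIntegers

section Abelian

variable {A F : Type*} [AddCommGroup A] [Field F] {f : A → A → F} {R : Set A}

namespace IsBiadditive

variable (hf : IsBiadditive f)
include hf

theorem sub_left (a b c : A) : f (a - b) c = f a c - f b c :=
  LinearMap.map_sub₂ (toIntBilin f hf) a b c

theorem sub_right (a b c : A) : f a (b - c) = f a b - f a c :=
  map_sub (toIntBilin f hf a) b c

theorem neg_left (a b : A) : f (-a) b = -f a b :=
  LinearMap.map_neg₂ (toIntBilin f hf) a b

theorem neg_right (a b : A) : f a (-b) = -f a b :=
  map_neg (toIntBilin f hf a) b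

theorem zero_left (a : A) : f 0 a = 0 :=
  LinearMap.map_zero₂ (toIntBilin f hf) a

theorem zsmul_left (n : ℤ) (a b : A) : f (n • a) b = n * f a b := by
  rw [← zsmul_eq_mul]
  exact LinearMap.map_smul₂ (toIntBilin f hf) n a b

theorem zsmul_right (n : ℤ) (a b : A) : f a (n • b) = n * f a b := by
  rw [← zsmul_eq_mul]
  exact map_smul (toIntBilin f hf a) n b

/-- A bi-homomorphism that vanishes against two sets vanishes against the subgroups they
generate. -/
theorem eq_zero_of_mem_closure {S T : Set A} (h : ∀ a ∈ S, ∀ b ∈ T, f a b = 0) {a b : A}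
    (ha : a ∈ AddSubgroup.closure S) (hb : b ∈ AddSubgroup.closure T) : f a b = 0 := by
  induction ha using AddSubgroup.closure_induction with
  | mem x hx =>
    induction hb using AddSubgroup.closure_induction with
    | mem y hy => exact h x hx y hy
    | zero => exact map_zero (toIntBilin f hf x)
    | add y z _ _ hy hz => rw [hf.2, hy, hz, add_zero]
    | neg y _ hy => rw [hf.neg_right, hy, neg_zero]
  | zero => exact hf.zero_left b
  | add y z _ _ hy hz => rw [hf.1, hy, hz, add_zero]
  | neg y _ hy => rw [hf.neg_left, hy, neg_zero]

end IsBiadditive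

namespace IsCartanInt

variable {α β : A} {m n : ℤ}

theorem neg_left (hf : IsBiadditive f) (hm : IsCartanInt f β α m) : IsCartanInt f (-β) α (-m) := by
  unfold IsCartanInt at *
  rw [hf.neg_left]; push_cast; linear_combination -hm

theorem sub (hf : IsBiadditive f) (hm : IsCartanInt f β α m) :
    IsCartanInt f (β - α) α (m - 2) := by
  unfold IsCartanInt at *
  rw [hf.sub_left]; push_cast; linear_combination hm

theorem zsmul_add_zsmul (hf : IsBiadditive f) (hm : IsCartanInt f β α m) (x y : ℤ) :
    IsCartanInt f (x • α + y • β) α (2 * x + m * y) := by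
  unfold IsCartanInt at *
  rw [hf.1, hf.zsmul_left, hf.zsmul_left]
  push_cast
  linear_combination (y : F) * hm

/-- Reflections are isometries. -/
theorem form_reflection (hf : IsBiadditive f) (hs : IsSymmetric f) (hm : IsCartanInt f β α m) :
    f (β - m • α) (β - m • α) = f β β := by
  unfold IsCartanInt at *
  rw [hf.sub_left, hf.sub_right, hf.sub_right, hf.zsmul_left, hf.zsmul_left, hf.zsmul_right,
    hf.zsmul_right, hs α β]
  linear_combination (-m : F) * hm

end IsCartanInt

/-! ### Cartan integers of real roots -/

theorem mem_nzRealRoots_of_mem_realRoots {x : A} (hx : x ∈ realRoots f R) (h0 : x ≠ 0) :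
    x ∈ nzRealRoots f R := by
  rcases hx with hx | hx
  · exact hx
  · exact absurd hx h0

namespace SatisfiesS

variable (h : SatisfiesS f R)
include h

theorem neg_mem_roots {α : A} (hα : α ∈ R) : -α ∈ R := by
  have := h.s2 ▸ hα
  exact this

theorem exists_isCartanInt (hs : IsSymmetric f) {α β : A} (hα : α ∈ nzRealRoots f R)
    (hβ : β ∈ R) : ∃ m : ℤ, IsCartanInt f β α m ∧ β - m • α ∈ R := by
  obtain ⟨m, hm, hmem⟩ := h.s3 α hα β hβ
  refine ⟨m, ?_, hmem⟩
  rw [div_eq_iff hα.2] at hm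
  rw [IsCartanInt, hs β α, hm]

theorem neg_mem_nzRealRoots (hf : IsBiadditive f) {α : A} (hα : α ∈ nzRealRoots f R) :
    -α ∈ nzRealRoots f R :=
  ⟨h.neg_mem_roots hα.1, by rw [hf.neg_left, hf.neg_right, neg_neg]; exact hα.2⟩

variable [CharZero F] {α β : A} {m n : ℤ}

theorem reflection_mem (hf : IsBiadditive f) (hs : IsSymmetric f) (hα : α ∈ nzRealRoots f R)
    (hβ : β ∈ nzRealRoots f R) (hm : IsCartanInt f β α m) : β - m • α ∈ nzRealRoots f R := by
  obtain ⟨m', hm', hmem⟩ := h.exists_isCartanInt hs hα hβ.1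
  obtain rfl := hm.unique hα.2 hm'
  exact ⟨hmem, by rw [hm.form_reflection hf hs]; exact hβ.2⟩

/-- The first step down a root string. -/
theorem sub_mem_realRoots (hα : α ∈ nzRealRoots f R)
    (hβ : β ∈ nzRealRoots f R) (hm : IsCartanInt f β α m) (h1 : 1 ≤ m) :
    β - α ∈ realRoots f R := by
  obtain ⟨p, q, hpq, hset⟩ := h.s4 α hα β hβ
  rw [div_eq_iff hα.2, hm] at hpq
  have := mul_right_cancel₀ hα.2 hpq
  have hmpq : m = (p : ℤ) - q := by exact_mod_cast this
  have hmem : β - α ∈ {x | ∃ k : ℤ, -(p : ℤ) ≤ k ∧ k ≤ (q : ℤ) ∧ x = β + k • α} :=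
    ⟨-1, by omega, by omega, by simp [sub_eq_add_neg]⟩
  rw [← hset] at hmem
  exact hmem.2

/-- Integrality of the Cartan integer of `α` against the root `β - α`. -/
theorem exists_isCartanInt_sub (hf : IsBiadditive f) (hs : IsSymmetric f)
    (hα : α ∈ nzRealRoots f R) (hβ : β ∈ nzRealRoots f R) (hm : IsCartanInt f β α m)
    (hn : IsCartanInt f α β n) (h3 : 3 ≤ m) :
    β - α ∈ nzRealRoots f R ∧
      ∃ k : ℤ, IsCartanInt f α (β - α) k ∧ n * (m - 2) = k * (n + m - n * m) := by
  have hre := h.sub_mem_realRoots hα hβ hm (by omega)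
  have hne : β - α ≠ 0 := by
    intro h0
    obtain rfl := sub_eq_zero.mp h0
    have := hm.unique hα.2 (IsCartanInt.self β)
    omega
  have hγ := mem_nzRealRoots_of_mem_realRoots hre hne
  obtain ⟨k, hk, -⟩ := h.exists_isCartanInt hs hγ hα.1
  refine ⟨hγ, k, hk, ?_⟩
  unfold IsCartanInt at hk hm hn
  rw [hf.sub_right, hf.sub_left, hf.sub_right, hf.sub_right, hs α β] at hk
  rw [hs α β] at hn
  have : ((n * (m - 2) : ℤ) : F) * f α α = (k * (n + m - n * m) : ℤ) * f α α := by
    push_cast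
    linear_combination (n : F) * hk + (-n * k - n) * hm - k * hn + k * hm
  exact_mod_cast mul_right_cancel₀ hα.2 this

/-- A Cartan integer `m ≥ 3` excludes a negative opposite one, because the Cartan integer of `α`
against `β - α` would be a nonzero fraction of absolute value below `1`. -/
theorem isCartanInt_nonneg_of_three_le (hf : IsBiadditive f) (hs : IsSymmetric f)
    (hα : α ∈ nzRealRoots f R) (hβ : β ∈ nzRealRoots f R) (hm : IsCartanInt f β α m)
    (hn : IsCartanInt f α β n) (h3 : 3 ≤ m) : 0 ≤ n := by
  by_contra! hneg
  obtain ⟨-, k, -, hk⟩ := h.exists_isCartanInt_sub hf hs hα hβ hm hn h3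
  -- `|n + m - n m| > |n (m - 2)| > 0`, so no integer `k` can satisfy `hk`
  have h1 : n * (m - 2) < 0 := by nlinarith
  have h2 : -(n * (m - 2)) < n + m - n * m := by nlinarith
  rcases lt_trichotomy k 0 with h0 | rfl | h0
  · nlinarith
  · rw [hk, zero_mul] at h1
    exact h1.ne rfl
  · nlinarith

/-- Cartan integers of opposite sign are impossible: applying `r_α` and `r_β` produces a pair whose
Cartan integers still have opposite signs and exceed `3` in absolute value. -/
theorem mul_isCartanInt_nonneg (hf : IsBiadditive f) (hs : IsSymmetric f)
    (hα : α ∈ nzRealRoots f R) (hβ : β ∈ nzRealRoots f R) (hm : IsCartanInt f β α m)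
    (hn : IsCartanInt f α β n) : 0 ≤ m * n := by
  by_contra! hneg
  have hα' := h.reflection_mem hf hs hβ hα hn
  have hβ' := h.reflection_mem hf hs hα hβ hm
  have hm' : IsCartanInt f (β - m • α) (α - n • β) (m * (m * n - 3)) := by
    have e := hn.form_reflection hf hs
    unfold IsCartanInt at *
    rw [e, hf.sub_left, hf.sub_right, hf.sub_right, hf.zsmul_left, hf.zsmul_left, hf.zsmul_right,
      hf.zsmul_right]
    rw [hs α β] at *
    push_cast
    linear_combination (m * n - 1 : F) * hm + 2 * hn
  have hn' : IsCartanInt f (α - n • β) (β - m • α) (n * (m * n - 3)) := by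
    have e := hm.form_reflection hf hs
    unfold IsCartanInt at *
    rw [e, hf.sub_left, hf.sub_right, hf.sub_right, hf.zsmul_left, hf.zsmul_left, hf.zsmul_right,
      hf.zsmul_right]
    rw [hs α β] at *
    push_cast
    linear_combination (m * n - 1 : F) * hn + 2 * hm
  rcases lt_or_ge m 0 with h0 | h0
  · have hn0 : 0 < n := by nlinarith
    have := h.isCartanInt_nonneg_of_three_le hf hs hα' hβ' hm' hn' (by nlinarith)
    nlinarith
  · have hn0 : n < 0 := by nlinarith
    have := h.isCartanInt_nonneg_of_three_le hf hs hβ' hα' hn' hm' (by nlinarith)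
    nlinarith

/-- A Cartan integer `m ≥ 3` forces the opposite one to be `1`, and then both Cartan integers of the
pair `α`, `β - α` are `m - 2`. -/
theorem eq_one_of_three_le (hf : IsBiadditive f) (hs : IsSymmetric f)
    (hα : α ∈ nzRealRoots f R) (hβ : β ∈ nzRealRoots f R) (hm : IsCartanInt f β α m)
    (hn : IsCartanInt f α β n) (h3 : 3 ≤ m) :
    n = 1 ∧ β - α ∈ nzRealRoots f R ∧ IsCartanInt f α (β - α) (m - 2) := by
  obtain ⟨hγ, k, hk, hkm⟩ := h.exists_isCartanInt_sub hf hs hα hβ hm hn h3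
  have hn0 : 0 < n := by
    have h1 := h.isCartanInt_nonneg_of_three_le hf hs hα hβ hm hn h3
    have h2 := hm.eq_zero_iff (hs α β) hα.2 hβ.2 hn
    omega
  have hk0 := h.mul_isCartanInt_nonneg hf hs hα hγ (hm.sub hf) hk
  have hk1 : 0 ≤ k := by nlinarith
  have h1 : 0 < n * (m - 2) := by nlinarith
  have h2 : 0 < n + m - n * m := by
    rw [hkm] at h1
    exact pos_of_mul_pos_right h1 hk1
  obtain rfl : n = 1 := by nlinarith
  refine ⟨rfl, hγ, ?_⟩
  have : k = m - 2 := by linarith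
  exact this ▸ hk

theorem isCartanInt_le_four (hf : IsBiadditive f) (hs : IsSymmetric f)
    (hα : α ∈ nzRealRoots f R) (hβ : β ∈ nzRealRoots f R) (hm : IsCartanInt f β α m) :
    m ≤ 4 := by
  by_contra! h5
  obtain ⟨n, hn, -⟩ := h.exists_isCartanInt hs hβ hα.1
  obtain ⟨-, hγ, hk⟩ := h.eq_one_of_three_le hf hs hα hβ hm hn (by omega)
  -- `β - α` and `α` have both Cartan integers equal to `m - 2 ≥ 3`
  have := (h.eq_one_of_three_le hf hs hα hγ (hm.sub hf) hk (by omega)).1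
  omega

theorem isCartanInt_mem_Icc (hf : IsBiadditive f) (hs : IsSymmetric f)
    (hα : α ∈ nzRealRoots f R) (hβ : β ∈ nzRealRoots f R) (hm : IsCartanInt f β α m) :
    m ∈ Set.Icc (-4 : ℤ) 4 := by
  have h1 := h.isCartanInt_le_four hf hs hα hβ hm
  have h2 := h.isCartanInt_le_four hf hs hα (h.neg_mem_nzRealRoots hf hβ) (hm.neg_left hf)
  exact ⟨by omega, h1⟩

/-- Real roots are separated by their values on real roots: the difference of two real roots with
equal values is isotropic and lies in a root string, hence vanishes. -/
theorem eq_of_forall_form_eq (hf : IsBiadditive f) (hs : IsSymmetric f)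
    (hα : α ∈ nzRealRoots f R) (hβ : β ∈ nzRealRoots f R)
    (heq : ∀ γ ∈ nzRealRoots f R, f α γ = f β γ) : α = β := by
  have e1 := heq α hα
  have e2 := heq β hβ
  have h2 : IsCartanInt f β α 2 := by
    unfold IsCartanInt; rw [← e1]; push_cast; rfl
  rcases h.sub_mem_realRoots hα hβ h2 (by norm_num) with h0 | h0
  · refine absurd ?_ h0.2
    rw [hf.sub_left, hf.sub_right, hf.sub_right, ← e1, ← e2, hs α β, ← heq α hα, e1, hs β α, e2]
    ring
  · exact (sub_eq_zero.mp h0).symm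

end SatisfiesS

end Abelian

/-! ### Vectors fixed by a finite reflection group -/

/-- If a finite set `Φ` spans `M` and is stable under its reflections, the only vector killed by all
coroots is `0`: the sum `∑ g` over the finitely many endomorphisms `g` that preserve `Φ` and fix `x`
is unchanged by composition with a reflection, so it kills every root and hence `x`. -/
theorem eq_zero_of_forall_coroot_eq_zero {M : Type*} [AddCommGroup M] [IsAddTorsionFree M]
    {Φ : Set M} (hfin : Φ.Finite) (hspan : AddSubgroup.closure Φ = ⊤) (φ : M → Module.Dual ℤ M)
    (htwo : ∀ α ∈ Φ, φ α α = 2) (hmaps : ∀ α ∈ Φ, ∀ β ∈ Φ, β - φ α β • α ∈ Φ) {x : M}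
    (hx : ∀ α ∈ Φ, φ α x = 0) : x = 0 := by
  classical
  set E : Set (Module.End ℤ M) := {g | Set.MapsTo g Φ Φ ∧ g x = x}
  have hext : ∀ g g' : Module.End ℤ M, (∀ α ∈ Φ, g α = g' α) → g = g' := by
    intro g g' h
    have h1 : (g : M →+ M) = (g' : M →+ M) := AddMonoidHom.eq_of_eqOn_dense hspan h
    exact LinearMap.ext fun y => DFunLike.congr_fun h1 y
  have hEfin : E.Finite := by
    have := hfin.to_subtype
    have hinj : Function.Injective fun (g : E) (α : Φ) => (⟨g.1 α.1, g.2.1 α.2⟩ : Φ) := by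
      intro g g' h
      refine Subtype.ext (hext _ _ fun α hα => ?_)
      exact congrArg Subtype.val (congrFun h ⟨α, hα⟩)
    have : Finite E := Finite.of_injective _ hinj
    exact Set.toFinite E
  have hroot : ∀ α ∈ Φ, ∑ g ∈ hEfin.toFinset, g α = 0 := by
    intro α hα
    have hinv := Module.involutive_preReflection (htwo α hα)
    have hmem : ∀ g ∈ hEfin.toFinset,
        g * Module.preReflection α (φ α) ∈ hEfin.toFinset := by
      intro g hg
      rw [Set.Finite.mem_toFinset] at hg ⊢
      refine ⟨fun β hβ => hg.1 ?_, ?_⟩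
      · rw [Module.preReflection_apply]
        exact hmaps α hα β hβ
      · rw [Module.End.mul_apply, Module.preReflection_apply, hx α hα, zero_smul, sub_zero]
        exact hg.2
    have hsum : ∑ g ∈ hEfin.toFinset, g α = ∑ g ∈ hEfin.toFinset, -(g α) := by
      refine Finset.sum_bij' (fun g _ => g * Module.preReflection α (φ α))
        (fun g _ => g * Module.preReflection α (φ α)) hmem hmem ?_ ?_ ?_
      · intro g _
        ext y
        simp [hinv y]
      · intro g _
        ext y
        simp [hinv y]
      · intro g _
        rw [Module.End.mul_apply, Module.preReflection_apply_self (htwo α hα), map_neg, neg_neg]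
    rw [Finset.sum_neg_distrib] at hsum
    exact self_eq_neg.mp hsum
  have hall : (∑ g ∈ hEfin.toFinset, g) = 0 :=
    hext _ _ fun α hα => by simpa using hroot α hα
  have hsumx : ∑ g ∈ hEfin.toFinset, g x = 0 := by
    rw [← LinearMap.sum_apply, hall, LinearMap.zero_apply]
  rw [Finset.sum_congr rfl fun g hg => ((Set.Finite.mem_toFinset hEfin).mp hg).2,
    Finset.sum_const] at hsumx
  refine (smul_eq_zero.mp hsumx).resolve_left (Finset.card_ne_zero_of_mem (a := 1) ?_)
  rw [Set.Finite.mem_toFinset]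
  exact ⟨fun β hβ => hβ, rfl⟩

/-! ### Extension of scalars -/

/-- Every tensor over `ℤ` is a sum of pure tensors whose left factors are linearly independent. -/
theorem exists_linearIndependent_sum_tmul {F A : Type*} [AddCommGroup F] [IsAddTorsionFree F]
    [AddCommGroup A] (x : F ⊗[ℤ] A) :
    ∃ (ι : Type) (_ : Fintype ι) (e : ι → F) (a : ι → A), LinearIndependent ℤ e ∧
      x = ∑ i, e i ⊗ₜ[ℤ] a i := by
  obtain ⟨T, hT, hx⟩ := TensorProduct.exists_finite_submodule_left_of_setFinite {x}
    (Set.finite_singleton x)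
  obtain ⟨y, rfl⟩ := hx rfl
  have : Module.Free ℤ T := inferInstance
  let b := Module.finBasis ℤ T
  obtain ⟨c, rfl⟩ := TensorProduct.eq_repr_basis_left b y
  refine ⟨Fin (Module.finrank ℤ T), inferInstance, fun i => (b i : F), c, ?_, ?_⟩
  · exact b.linearIndependent.map' T.subtype (Submodule.ker_subtype T)
  · rw [Finsupp.sum_fintype _ _ (by simp), map_sum]
    simp

section Abelian

variable {A F : Type*} [AddCommGroup A] [Field F] {f : A → A → F} {R : Set A}

theorem isAddTorsionFree_of_radical_eq [CharZero F] (hf : IsBiadditive f)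
    (hrad : radical f = {0}) : IsAddTorsionFree A := by
  refine isAddTorsionFree_iff_not_isOfFinAddOrder.mpr fun a ha h => ha ?_
  obtain ⟨n, hn, hna⟩ := isOfFinAddOrder_iff_nsmul_eq_zero.mp h
  have : a ∈ radical f := by
    intro b
    have h1 := hf.zsmul_left n a b
    rw [natCast_zsmul, hna, hf.zero_left] at h1
    simpa [hn.ne'] using h1.symm
  rwa [hrad] at this

/-- Extension of scalars maps the subgroup generated by `S` into the `F`-span of `1 ⊗ S`. -/
theorem one_tmul_mem_span {S : Set A} {a : A} (ha : a ∈ AddSubgroup.closure S) :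
    (1 : F) ⊗ₜ[ℤ] a ∈ Submodule.span F ((fun a : A => (1 : F) ⊗ₜ[ℤ] a) '' S) := by
  induction ha using AddSubgroup.closure_induction with
  | mem x hx => exact Submodule.subset_span ⟨x, hx, rfl⟩
  | zero => rw [TensorProduct.tmul_zero]; exact zero_mem _
  | add x y _ _ hx hy => rw [TensorProduct.tmul_add]; exact add_mem hx hy
  | neg x _ hx => rw [TensorProduct.tmul_neg]; exact neg_mem hx

/-! ### Local finiteness and nondegeneracy of the real roots -/

namespace SatisfiesS

variable [CharZero F] (h : SatisfiesS f R)
include h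

/-- Local finiteness: on a finite dimensional subspace finitely many functionals `(·, γ)` determine
all the others, so they separate the real roots, on which they take finitely many values. -/
theorem finite_setOf_one_tmul_mem (hf : IsBiadditive f) (hs : IsSymmetric f)
    (U : Submodule F (F ⊗[ℤ] A)) [FiniteDimensional F U] :
    {β | β ∈ nzRealRoots f R ∧ (1 : F) ⊗ₜ[ℤ] β ∈ U}.Finite := by
  classical
  let ψ : A → Module.Dual F U := fun γ =>
    (extendForm f hf).flip ((1 : F) ⊗ₜ[ℤ] γ) ∘ₗ U.subtype
  have hψ : ∀ β γ, ∀ hβ : (1 : F) ⊗ₜ[ℤ] β ∈ U, ψ γ ⟨_, hβ⟩ = f β γ := by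
    intro β γ hβ
    simp [ψ, extendForm_tmul]
  obtain ⟨s, hsub, hspan⟩ := (Submodule.fg_span_iff_fg_span_finset_subset (R := F)
    (ψ '' nzRealRoots f R)).mp (IsNoetherian.noetherian _)
  obtain ⟨G, hG, rfl⟩ := Finset.subset_set_image_iff.mp hsub
  have hfin : (Set.univ.pi fun γ : G =>
      (fun m : ℤ => (m : F) * f γ γ / 2) '' Set.Icc (-4) 4).Finite :=
    Set.Finite.pi fun γ => (Set.finite_Icc _ _).image _
  refine Set.Finite.of_injOn (f := fun β (γ : G) => f β γ) ?_ ?_ hfin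
  · rintro β ⟨hβ, -⟩ γ -
    have hγ := hG γ.2
    obtain ⟨m, hm, -⟩ := h.exists_isCartanInt hs hγ hβ.1
    refine ⟨m, h.isCartanInt_mem_Icc hf hs hγ hβ hm, ?_⟩
    change (m : F) * f γ γ / 2 = f β γ
    rw [← hm, mul_div_cancel_left₀ _ (two_ne_zero)]
  · rintro β ⟨hβ, hβU⟩ β' ⟨hβ', hβU'⟩ heq
    refine h.eq_of_forall_form_eq hf hs hβ hβ' fun γ hγ => ?_
    have hle : Submodule.span F (ψ '' nzRealRoots f R) ≤
        LinearMap.eqLocus (Module.Dual.eval F U ⟨_, hβU⟩) (Module.Dual.eval F U ⟨_, hβU'⟩) := by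
      rw [hspan, Submodule.span_le]
      intro θ hθ
      simp only [Finset.coe_image, Set.mem_image] at hθ
      obtain ⟨δ, hδ, rfl⟩ := hθ
      change ψ δ ⟨_, hβU⟩ = ψ δ ⟨_, hβU'⟩
      rw [hψ, hψ]
      exact congrFun heq ⟨δ, hδ⟩
    have : ψ γ ⟨_, hβU⟩ = ψ γ ⟨_, hβU'⟩ := hle (Submodule.subset_span ⟨γ, hγ, rfl⟩)
    rwa [hψ, hψ] at this

/-- The coroot of a real root, as an integral functional on the whole group. -/
theorem exists_coroot (hf : IsBiadditive f) (hs : IsSymmetric f) {α : A}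
    (hα : α ∈ nzRealRoots f R) : ∃ φ : Module.Dual ℤ A, ∀ a, IsCartanInt f a α (φ a) := by
  have hex : ∀ a, ∃ m : ℤ, IsCartanInt f a α m := by
    intro a
    have ha : a ∈ AddSubgroup.closure R := h.s1.2 ▸ AddSubgroup.mem_top a
    induction ha using AddSubgroup.closure_induction with
    | mem x hx => exact (h.exists_isCartanInt hs hα hx).imp fun _ => And.left
    | zero => exact ⟨0, by simp [IsCartanInt, hf.zero_left]⟩
    | add x y _ _ hx hy =>
      obtain ⟨m, hm⟩ := hx
      obtain ⟨n, hn⟩ := hy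
      refine ⟨m + n, ?_⟩
      unfold IsCartanInt at *
      rw [hf.1]; push_cast; linear_combination hm + hn
    | neg x _ hx =>
      obtain ⟨m, hm⟩ := hx
      exact ⟨-m, hm.neg_left hf⟩
  choose φ hφ using hex
  refine ⟨(AddMonoidHom.mk' φ fun a b => (hφ (a + b)).unique hα.2 ?_).toIntLinearMap, hφ⟩
  have ha := hφ a
  have hb := hφ b
  unfold IsCartanInt at *
  rw [hf.1]; push_cast; linear_combination ha + hb

/-- The span of the real roots is nondegenerate. -/
theorem eq_zero_of_mem_closure_real (hf : IsBiadditive f) (hs : IsSymmetric f)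
    [IsAddTorsionFree A] {x : A} (hx : x ∈ AddSubgroup.closure (nzRealRoots f R))
    (hort : ∀ α ∈ nzRealRoots f R, f x α = 0) : x = 0 := by
  classical
  rw [← Submodule.span_int_eq_addSubgroupClosure, Submodule.mem_toAddSubgroup] at hx
  obtain ⟨S, hS, hxS⟩ := Submodule.mem_span_finite_of_mem_span hx
  rw [← Submodule.mem_toAddSubgroup, Submodule.span_int_eq_addSubgroupClosure] at hxS
  set M := AddSubgroup.closure (S : Set A)
  -- the roots lying in the finitely generated group `M` form a finite set
  have hfin : {β | β ∈ nzRealRoots f R ∧ β ∈ M}.Finite := by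
    let U := Submodule.span F ((fun a : A => (1 : F) ⊗ₜ[ℤ] a) '' S)
    have : FiniteDimensional F U :=
      FiniteDimensional.span_of_finite F (S.finite_toSet.image _)
    exact (h.finite_setOf_one_tmul_mem hf hs U).subset
      fun β hβ => ⟨hβ.1, one_tmul_mem_span hβ.2⟩
  choose! φ hφ using fun α (hα : α ∈ nzRealRoots f R) => h.exists_coroot hf hs hα
  suffices hz : (⟨x, hxS⟩ : M) = 0 from congrArg Subtype.val hz
  refine eq_zero_of_forall_coroot_eq_zero (Φ := (↑) ⁻¹' nzRealRoots f R)
    (φ := fun α : M => φ α ∘ₗ M.subtype.toIntLinearMap) ?_ ?_ ?_ ?_ ?_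
  · exact (hfin.preimage Subtype.val_injective.injOn).subset fun β hβ => ⟨hβ, β.2⟩
  · rw [eq_top_iff, ← AddSubgroup.closure_closure_coe_preimage (k := (S : Set A))]
    exact AddSubgroup.closure_mono (Set.preimage_mono hS)
  · intro α hα
    exact (hφ α hα α).unique hα.2 (IsCartanInt.self _)
  · intro α hα β hβ
    exact h.reflection_mem hf hs hα hβ (hφ α hα β)
  · intro α hα
    refine (hφ α hα x).unique hα.2 ?_
    simp [IsCartanInt, hort α hα]

/-! ### Vectors orthogonal to the real roots -/

/-- Fix an isotropic root `δ`. On the vectors orthogonal to all real roots, the functional `(·, δ)`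
has rank one over `ℤ`: its values are rational multiples of a single scalar. -/
theorem exists_int_mul_form_eq (hf : IsBiadditive f) (hs : IsSymmetric f) [IsAddTorsionFree A]
    {δ : A} (hδ : δ ∈ nsRoots f R) :
    ∃ (k : ℤ) (q : F), k ≠ 0 ∧ ∀ a : A, (∀ α ∈ nzRealRoots f R, f a α = 0) →
      ∃ m : ℤ, k * f a δ = m * q := by
  set W := AddSubgroup.closure (nzRealRoots f R)
  -- isotropic roots congruent to `± δ` modulo the span of the real roots
  set D : Set A := {γ | γ ∈ nsRoots f R ∧ (γ - δ ∈ W ∨ γ + δ ∈ W)}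
  have hδD : δ ∈ D := ⟨hδ, Or.inl (by simp)⟩
  -- roots not orthogonal to `D`
  set C : Set A := {γ | γ ∈ R ∧ ∃ d ∈ D, f d γ ≠ 0}
  have hCns : ∀ γ ∈ C, f γ γ = 0 → γ ∈ D := by
    rintro γ ⟨hγ, d, ⟨hd, hdW⟩, hne⟩ h0
    have hor : γ - d ∈ W ∨ γ + d ∈ W := by
      refine (h.s5 d hd γ hγ hne).imp (fun hm => ?_) (fun hm => ?_) <;>
      · refine AddSubgroup.subset_closure ⟨hm, ?_⟩
        simp only [hf.1, hf.2, hf.sub_left, hf.sub_right, h0, hd.2, hs γ d]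
        intro he
        apply hne
        have : (2 : F) * f d γ = 0 := by first | linear_combination he | linear_combination -he
        simpa using this
    refine ⟨⟨hγ, h0⟩, ?_⟩
    rcases hor with h1 | h1 <;> rcases hdW with h2 | h2
    · left; convert add_mem h1 h2 using 1; abel
    · right; convert add_mem h1 h2 using 1; abel
    · right; convert sub_mem h1 h2 using 1; abel
    · left; convert sub_mem h1 h2 using 1; abel
  have hort : ∀ γ ∈ C, ∀ γ' ∈ R \ C, f γ γ' = 0 := by
    rintro γ hγC γ' ⟨hγ', hnC⟩
    have hDγ' : ∀ d ∈ D, f d γ' = 0 := by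
      intro d hd
      by_contra hne
      exact hnC ⟨hγ', d, hd, hne⟩
    by_cases h0 : f γ γ = 0
    · exact hDγ' γ (hCns γ hγC h0)
    · obtain ⟨hγ, d, hd, hne⟩ := hγC
      -- `r_γ d` lies in `D` again
      obtain ⟨m, hm, hmem⟩ := h.exists_isCartanInt hs ⟨hγ, h0⟩ hd.1.1
      have hmW : m • γ ∈ W := zsmul_mem (AddSubgroup.subset_closure (k := nzRealRoots f R) ⟨hγ, h0⟩) m
      have hd' : d - m • γ ∈ D := by
        refine ⟨⟨hmem, by rw [hm.form_reflection hf hs, hd.1.2]⟩, ?_⟩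
        refine hd.2.imp (fun h2 => ?_) (fun h2 => ?_)
        · convert sub_mem h2 hmW using 1; abel
        · convert sub_mem h2 hmW using 1; abel
      have h1 := hDγ' _ hd'
      rw [hf.sub_left, hDγ' d hd, hf.zsmul_left, zero_sub, neg_eq_zero, mul_eq_zero] at h1
      refine h1.resolve_left fun hm0 => ?_
      have : 2 * f d γ = 0 := by rw [hm, hm0, zero_mul]
      simp [hne] at this
  -- every root in `C` lies in `W + ℤ δ`
  have hCW : ∀ a ∈ AddSubgroup.closure C, ∃ c : ℤ, a - c • δ ∈ W := by
    intro a ha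
    induction ha using AddSubgroup.closure_induction with
    | mem γ hγ =>
      by_cases h0 : f γ γ = 0
      · rcases (hCns γ hγ h0).2 with h1 | h1
        · exact ⟨1, by simpa using h1⟩
        · exact ⟨-1, by simpa using h1⟩
      · exact ⟨0, by simpa using AddSubgroup.subset_closure (k := nzRealRoots f R) ⟨hγ.1, h0⟩⟩
    | zero => exact ⟨0, by simp⟩
    | add x y _ _ hx hy =>
      obtain ⟨m, hm⟩ := hx
      obtain ⟨n, hn⟩ := hy
      refine ⟨m + n, ?_⟩
      convert add_mem hm hn using 1
      rw [add_smul]; abel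
    | neg x _ hx =>
      obtain ⟨m, hm⟩ := hx
      refine ⟨-m, ?_⟩
      convert neg_mem hm using 1
      rw [neg_smul]; abel
  -- replace `a` by its component in the span of `C`
  have hcomp : ∀ a : A, (∀ α ∈ nzRealRoots f R, f a α = 0) →
      ∃ (b : A) (c : ℤ), (∀ α ∈ nzRealRoots f R, f b α = 0) ∧ b - c • δ ∈ W ∧ f b δ = f a δ := by
    intro a ha
    have hmem : a ∈ AddSubgroup.closure C ⊔ AddSubgroup.closure (R \ C) := by
      rw [← AddSubgroup.closure_union, Set.union_sdiff_cancel fun γ (hγ : γ ∈ C) => hγ.1, h.s1.2]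
      exact AddSubgroup.mem_top a
    obtain ⟨b, hb, b', hb', rfl⟩ := AddSubgroup.mem_sup.mp hmem
    obtain ⟨c, hc⟩ := hCW b hb
    refine ⟨b, c, fun α hα => ?_, hc, ?_⟩
    · by_cases hαC : α ∈ C
      · have h1 := ha α hα
        rwa [hf.1, hs b' α, hf.eq_zero_of_mem_closure hort (AddSubgroup.subset_closure hαC) hb',
          add_zero] at h1
      · exact hf.eq_zero_of_mem_closure hort hb (AddSubgroup.subset_closure ⟨hα.1, hαC⟩)
    · have h0 : f b' δ = 0 := by
        refine hf.eq_zero_of_mem_closure (S := R \ C) (T := {δ}) ?_ hb'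
          (AddSubgroup.subset_closure rfl)
        rintro γ ⟨hγ, hnC⟩ _ rfl
        by_contra hne
        exact hnC ⟨hγ, _, hδD, by rwa [hs]⟩
      rw [hf.1, h0, add_zero]
  by_cases hall : ∀ a : A, (∀ α ∈ nzRealRoots f R, f a α = 0) → f a δ = 0
  · exact ⟨1, 0, one_ne_zero, fun a ha => ⟨0, by simp [hall a ha]⟩⟩
  push Not at hall
  obtain ⟨a₀, ha₀, hne⟩ := hall
  obtain ⟨b₀, c₀, hb₀, hc₀, hbδ⟩ := hcomp a₀ ha₀
  refine ⟨c₀, f b₀ δ, ?_, fun a ha => ?_⟩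
  · rintro rfl
    rw [zero_smul, sub_zero] at hc₀
    rw [← hbδ, h.eq_zero_of_mem_closure_real hf hs hc₀ hb₀, hf.zero_left] at hne
    exact hne rfl
  · obtain ⟨b, c, hb, hc, hbδ⟩ := hcomp a ha
    refine ⟨c, ?_⟩
    -- `c₀ b - c b₀` lies in the span of the real roots and is orthogonal to them
    have h0 : c₀ • b - c • b₀ = 0 := by
      refine h.eq_zero_of_mem_closure_real hf hs ?_ fun α hα => ?_
      · convert sub_mem (zsmul_mem hc c₀) (zsmul_mem hc₀ c) using 1
        rw [smul_sub, smul_sub, smul_smul, smul_smul, mul_comm c c₀]; abel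
      · rw [hf.sub_left, hf.zsmul_left, hf.zsmul_left, hb α hα, hb₀ α hα]; simp
    have h1 : f (c₀ • b - c • b₀) δ = 0 := by rw [h0, hf.zero_left]
    rw [hf.sub_left, hf.zsmul_left, hf.zsmul_left, hbδ] at h1
    exact sub_eq_zero.mp h1

/-! ### The extended form -/

/-- The form stays nondegenerate after extension of scalars. -/
theorem radical_extendForm (hf : IsBiadditive f) (hs : IsSymmetric f) (hrad : radical f = {0}) :
    radical (fun u v => extendForm f hf u v) = {0} := by
  have := isAddTorsionFree_of_radical_eq hf hrad
  refine Set.eq_singleton_iff_unique_mem.mpr ⟨fun v => by simp, fun x hx => ?_⟩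
  obtain ⟨ι, _, e, a, he, rfl⟩ := exists_linearIndependent_sum_tmul x
  have hsum : ∀ b, ∑ i, e i * f (a i) b = 0 := by
    intro b
    have := hx ((1 : F) ⊗ₜ[ℤ] b)
    simpa [extendForm_tmul] using this
  have hindep : ∀ m : ι → ℤ, ∑ i, e i * (m i : F) = 0 → ∀ i, m i = 0 := by
    intro m hm
    refine Fintype.linearIndependent_iff.mp he m ?_
    rw [← hm]
    exact Finset.sum_congr rfl fun i _ => by rw [zsmul_eq_mul, mul_comm]
  have hreal : ∀ i, ∀ α ∈ nzRealRoots f R, f (a i) α = 0 := by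
    intro i α hα
    obtain ⟨φ, hφ⟩ := h.exists_coroot hf hs hα
    have h0 : φ (a i) = 0 := by
      refine hindep (fun i => φ (a i)) ?_ i
      refine (mul_eq_zero.mp ?_).resolve_right hα.2
      rw [Finset.sum_mul, ← mul_zero (2 : F), ← hsum α, Finset.mul_sum]
      refine Finset.sum_congr rfl fun j _ => ?_
      have hj : 2 * f (a j) α = φ (a j) * f α α := hφ (a j)
      linear_combination -e j * hj
    have := hφ (a i)
    simpa [IsCartanInt, h0] using this
  have hroot : ∀ i, ∀ δ ∈ R, f (a i) δ = 0 := by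
    intro i δ hδ
    by_cases h0 : f δ δ = 0
    · obtain ⟨k, q, hk, hkq⟩ := h.exists_int_mul_form_eq hf hs ⟨hδ, h0⟩
      choose m hm using fun i => hkq (a i) (hreal i)
      have hk' : (k : F) ≠ 0 := by exact_mod_cast hk
      refine (mul_eq_zero.mp ?_).resolve_left hk'
      rw [hm]
      by_cases hq : q = 0
      · rw [hq, mul_zero]
      · rw [hindep m ?_ i, Int.cast_zero, zero_mul]
        refine (mul_eq_zero.mp ?_).resolve_right hq
        rw [Finset.sum_mul, ← mul_zero (k : F), ← hsum δ, Finset.mul_sum]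
        refine Finset.sum_congr rfl fun j _ => ?_
        linear_combination -e j * hm j
    · exact hreal i δ ⟨hδ, h0⟩
  have hzero : ∀ i, a i = 0 := by
    intro i
    rw [← Set.mem_singleton_iff, ← hrad]
    intro b
    refine hf.eq_zero_of_mem_closure (S := {a i}) (T := R) ?_ (AddSubgroup.subset_closure rfl)
      (h.s1.2 ▸ AddSubgroup.mem_top b)
    rintro _ rfl δ hδ
    exact hroot i δ hδ
  simp [hzero]

theorem isLocallyFiniteRootSupersystem (hf : IsBiadditive f) (hs : IsSymmetric f)
    (hrad : radical f = {0}) :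
    IsLocallyFiniteRootSupersystem (extendForm f hf) ((fun a : A => (1 : F) ⊗ₜ[ℤ] a) '' R) where
  symm := by
    intro u v
    induction u using TensorProduct.induction_on with
    | zero => simp
    | add x y hx hy => simp only [map_add, LinearMap.add_apply, hx, hy]
    | tmul r a =>
      induction v using TensorProduct.induction_on with
      | zero => simp
      | add x y hx hy => simp only [map_add, LinearMap.add_apply, hx, hy]
      | tmul s b =>
        change extendForm f hf _ _ = extendForm f hf _ _
        rw [extendForm_tmul, extendForm_tmul, hs a b, mul_comm r s]
  nondegenerate := h.radical_extendForm hf hs hrad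
  zero_mem := ⟨0, h.s1.1, TensorProduct.tmul_zero _ _⟩
  locallyFinite := by
    intro W _ _
    refine (((h.finite_setOf_one_tmul_mem hf hs W).image
      (fun a : A => (1 : F) ⊗ₜ[ℤ] a)).union (Set.finite_singleton 0)).subset ?_
    rintro _ ⟨hW, ⟨⟨a, ha, rfl⟩, hne⟩ | h0⟩
    · refine Or.inl ⟨a, ⟨⟨ha, ?_⟩, hW⟩, rfl⟩
      simpa [extendForm_tmul] using hne
    · exact Or.inr h0
  neg_eq := by
    ext v
    constructor
    · rintro ⟨a, ha, rfl⟩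
      exact ⟨-a, h.neg_mem_roots ha, TensorProduct.tmul_neg _ _⟩
    · rintro ⟨a, ha, hav⟩
      refine ⟨-a, h.neg_mem_roots ha, ?_⟩
      simp only at hav ⊢
      rw [TensorProduct.tmul_neg, hav, neg_neg]
  span_eq_top := by
    refine eq_top_iff.mpr fun x _ => ?_
    induction x using TensorProduct.induction_on with
    | zero => exact zero_mem _
    | add x y hx hy => exact add_mem (hx trivial) (hy trivial)
    | tmul r a =>
      have := Submodule.smul_mem _ r
        (one_tmul_mem_span (F := F) (S := R) (a := a) (h.s1.2 ▸ AddSubgroup.mem_top a))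
      rwa [TensorProduct.smul_tmul', smul_eq_mul, mul_one] at this
  reflection := by
    rintro _ ⟨⟨α, hα, rfl⟩, hne⟩ _ ⟨β, hβ, rfl⟩
    have hα' : α ∈ nzRealRoots f R := ⟨hα, by simpa [extendForm_tmul] using hne⟩
    obtain ⟨m, hm, hmem⟩ := h.exists_isCartanInt hs hα' hβ
    have hdiv : 2 * extendForm f hf ((1 : F) ⊗ₜ[ℤ] β) ((1 : F) ⊗ₜ[ℤ] α) /
        extendForm f hf ((1 : F) ⊗ₜ[ℤ] α) ((1 : F) ⊗ₜ[ℤ] α) = m := by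
      rw [extendForm_tmul, extendForm_tmul, one_mul, one_mul, one_mul, div_eq_iff hα'.2]
      exact hm
    refine ⟨⟨m, hdiv⟩, β - m • α, hmem, ?_⟩
    simp only
    rw [hdiv, TensorProduct.tmul_sub, TensorProduct.tmul_smul, Int.cast_smul_eq_zsmul]
  nonsingular := by
    rintro _ ⟨⟨α, hα, rfl⟩, h0⟩ _ ⟨β, hβ, rfl⟩ hne
    refine (h.s5 α ⟨hα, by simpa [extendForm_tmul] using h0⟩ β hβ
      (by simpa [extendForm_tmul] using hne)).imp (fun hm => ?_) (fun hm => ?_)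
    · exact ⟨_, hm, TensorProduct.tmul_sub _ _ _⟩
    · exact ⟨_, hm, TensorProduct.tmul_add _ _ _⟩

end SatisfiesS

end Abelian

/-! ### Root strings in a locally finite root supersystem -/

section Supersystem

variable {F V : Type*} [Field F] [AddCommGroup V] [Module F V]

theorem isBiadditive_bilinForm (B : LinearMap.BilinForm F V) :
    IsBiadditive (fun u v => B u v) :=
  ⟨fun a b c => LinearMap.map_add₂ B a b c, fun a b c => map_add (B a) b c⟩

theorem zsmul_add_zsmul_mem_span_pair (α β : V) (x y : ℤ) :
    x • α + y • β ∈ Submodule.span F {α, β} :=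
  add_mem (zsmul_mem (Submodule.subset_span (by simp)) x)
    (zsmul_mem (Submodule.subset_span (by simp)) y)

namespace IsLocallyFiniteRootSupersystem

variable {B : LinearMap.BilinForm F V} {R : Set V} (h : IsLocallyFiniteRootSupersystem B R)
include h

theorem exists_isCartanInt {α β : V} (hα : α ∈ nzRealRoots (fun u v => B u v) R) (hβ : β ∈ R) :
    ∃ m : ℤ, IsCartanInt (fun u v => B u v) β α m ∧ β - m • α ∈ R := by
  obtain ⟨⟨m, hm⟩, hmem⟩ := h.reflection α hα β hβ
  rw [hm, Int.cast_smul_eq_zsmul] at hmem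
  exact ⟨m, (div_eq_iff hα.2).mp hm, hmem⟩

theorem radical_restrict : radical (fun a b : AddSubgroup.closure R => B (a : V) (b : V)) = {0} := by
  refine Set.eq_singleton_iff_unique_mem.mpr ⟨fun b => by simp, fun a ha => Subtype.ext ?_⟩
  rw [ZeroMemClass.coe_zero, ← Set.mem_singleton_iff, ← h.nondegenerate]
  intro v
  have hle : Submodule.span F R ≤ LinearMap.ker (B a) :=
    Submodule.span_le.mpr fun r hr => ha ⟨r, AddSubgroup.subset_closure hr⟩
  exact hle (h.span_eq_top ▸ Submodule.mem_top)

theorem finite_realRoots_inter_span_pair {α β : V} (hα : α ∈ nzRealRoots (fun u v => B u v) R)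
    (hβ : β ∈ nzRealRoots (fun u v => B u v) R) :
    ((Submodule.span F {α, β} : Set V) ∩ realRoots (fun u v => B u v) R).Finite := by
  refine h.locallyFinite _ (Submodule.span_mono ?_)
    (FiniteDimensional.span_of_finite F (Set.toFinite _))
  rintro _ (rfl | rfl)
  · exact Or.inl hα
  · exact Or.inl hβ

variable [CharZero F] {α β : V} {m n : ℤ}

theorem reflection_mem_realRoots (hα : α ∈ nzRealRoots (fun u v => B u v) R)
    (hβ : β ∈ realRoots (fun u v => B u v) R) (hm : IsCartanInt (fun u v => B u v) β α m) :
    β - m • α ∈ realRoots (fun u v => B u v) R := by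
  rcases hβ with hβ | rfl
  · obtain ⟨m', hm', hmem⟩ := h.exists_isCartanInt hα hβ.1
    obtain rfl := hm.unique hα.2 hm'
    refine Or.inl ⟨hmem, ?_⟩
    exact (hm.form_reflection (isBiadditive_bilinForm B) h.symm).trans_ne hβ.2
  · have : m = 0 := hm.unique hα.2 (by simp [IsCartanInt])
    exact Or.inr (by simp [this])

/-- Rank two finiteness bounds the product of the Cartan integers. If `m n ∉ [0, 4]` then `α`, `β`
are independent, and no root `x α + y β` with `(x, y) ≠ 0` can
maximize `|x| + |y|`: one of the two reflections
increases it. -/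
theorem mul_isCartanInt_mem_Icc (hα : α ∈ nzRealRoots (fun u v => B u v) R)
    (hβ : β ∈ nzRealRoots (fun u v => B u v) R) (hm : IsCartanInt (fun u v => B u v) β α m)
    (hn : IsCartanInt (fun u v => B u v) α β n) : 0 ≤ m * n ∧ m * n ≤ 4 := by
  by_contra hmn
  have hα' : α ∈ realRoots (fun u v => B u v) R := Or.inl hα
  have hne : m * n ≠ 4 := fun h4 => hmn (by omega)
  have hm0 : m ≠ 0 := by rintro rfl; simp at hmn
  have hn0 : n ≠ 0 := by rintro rfl; simp at hmn
  have hmα := hm.zsmul_add_zsmul (isBiadditive_bilinForm B)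
  have hnβ : ∀ x y : ℤ, IsCartanInt (fun u v => B u v) (x • α + y • β) β (2 * y + n * x) := by
    intro x y
    rw [add_comm]
    exact hn.zsmul_add_zsmul (isBiadditive_bilinForm B) y x
  let g : ℤ × ℤ → V := fun z => z.1 • α + z.2 • β
  have hker : ∀ x y : ℤ, x • α + y • β = 0 → x = 0 ∧ y = 0 := by
    intro x y h0
    have e1 : 2 * x + m * y = 0 := (hmα x y).unique hα.2 (by simp [IsCartanInt, h0])
    have e2 : 2 * y + n * x = 0 := (hnβ x y).unique hβ.2 (by simp [IsCartanInt, h0])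
    have e3 : (4 - m * n) * x = 0 := by linear_combination 2 * e1 - m * e2
    have hx : x = 0 := (mul_eq_zero.mp e3).resolve_left (by omega)
    subst hx
    exact ⟨rfl, by omega⟩
  have hinj : Function.Injective g := by
    rintro ⟨x, y⟩ ⟨x', y'⟩ he
    have := hker (x - x') (y - y') (by
      rw [sub_smul, sub_smul, sub_add_sub_comm]; exact sub_eq_zero.mpr he)
    exact Prod.ext (by simpa using sub_eq_zero.mp this.1) (by simpa using sub_eq_zero.mp this.2)
  set T : Set (ℤ × ℤ) := {z | z ≠ 0 ∧ g z ∈ realRoots (fun u v => B u v) R}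
  have hTfin : T.Finite :=
    ((h.finite_realRoots_inter_span_pair hα hβ).preimage hinj.injOn).subset
      fun z hz => ⟨zsmul_add_zsmul_mem_span_pair α β z.1 z.2, hz.2⟩
  obtain ⟨⟨x, y⟩, ⟨hz0, hz⟩, hmax⟩ := Set.exists_max_image T (fun z => |z.1| + |z.2|) hTfin
    ⟨(1, 0), by simp, by simpa [g] using hα'⟩
  have h1 : |x + m * y| ≤ |x| := by
    have hmem := h.reflection_mem_realRoots hα hz (hmα x y)
    have hle := hmax (-(x + m * y), y) ⟨?_, ?_⟩
    · rwa [abs_neg, add_le_add_iff_right] at hle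
    · intro h0
      rw [Prod.mk_eq_zero] at h0
      obtain ⟨h0, rfl⟩ := h0
      exact hz0 (by simpa using h0)
    · convert hmem using 1
      simp only [g]
      module
  have h2 : |y + n * x| ≤ |y| := by
    have hmem := h.reflection_mem_realRoots hβ hz (hnβ x y)
    have hle := hmax (x, -(y + n * x)) ⟨?_, ?_⟩
    · rwa [abs_neg, add_le_add_iff_left] at hle
    · intro h0
      rw [Prod.mk_eq_zero] at h0
      obtain ⟨rfl, h0⟩ := h0
      exact hz0 (by simpa using h0)
    · convert hmem using 1
      simp only [g]
      module
  have q1 : m * (2 * (x * y) + m * y ^ 2) ≤ 0 := by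
    have := sq_le_sq.mpr h1
    linarith [this, (by ring : (x + m * y) ^ 2 = x ^ 2 + m * (2 * (x * y) + m * y ^ 2))]
  have q2 : n * (2 * (x * y) + n * x ^ 2) ≤ 0 := by
    have := sq_le_sq.mpr h2
    linarith [this, (by ring : (y + n * x) ^ 2 = y ^ 2 + n * (2 * (x * y) + n * x ^ 2))]
  have hxy : x * y ≠ 0 := by
    intro h0
    rw [h0] at q1 q2
    have hy : (m * y) ^ 2 ≤ 0 := by linarith [(by ring : (m * y) ^ 2 = m * (2 * 0 + m * y ^ 2))]
    have hx : (n * x) ^ 2 ≤ 0 := by linarith [(by ring : (n * x) ^ 2 = n * (2 * 0 + n * x ^ 2))]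
    have hy0 : y = 0 := by simpa [hm0] using (sq_nonpos_iff _).mp hy
    have hx0 : x = 0 := by simpa [hn0] using (sq_nonpos_iff _).mp hx
    exact hz0 (by simp [hx0, hy0])
  have hpos : 0 < (x * y) ^ 2 := by positivity
  -- multiply the two inequalities `(m y)² ≤ -2 m x y` and `(n x)² ≤ -2 n x y`
  have q3 : (m * n) ^ 2 * (x * y) ^ 2 ≤ 4 * (m * n) * (x * y) ^ 2 := by
    have a1 : (m * y) ^ 2 ≤ -(2 * m * (x * y)) := by linarith [q1, (by ring :
      m * (2 * (x * y) + m * y ^ 2) = 2 * m * (x * y) + (m * y) ^ 2)]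
    have a2 : (n * x) ^ 2 ≤ -(2 * n * (x * y)) := by linarith [q2, (by ring :
      n * (2 * (x * y) + n * x ^ 2) = 2 * n * (x * y) + (n * x) ^ 2)]
    have := mul_le_mul a1 a2 (sq_nonneg _) ((sq_nonneg _).trans a1)
    calc (m * n) ^ 2 * (x * y) ^ 2 = (m * y) ^ 2 * (n * x) ^ 2 := by ring
      _ ≤ _ := this
      _ = _ := by ring
  have q4 : (m * n) ^ 2 ≤ 4 * (m * n) := le_of_mul_le_mul_right q3 hpos
  exact hmn ⟨by nlinarith [sq_nonneg (m * n)], by nlinarith⟩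

/-- If both Cartan integers are `2` then `r_α r_β` is a translation along `α - β` on
`α + ℤ (α - β)`, so finiteness forces `α = β`. -/
theorem eq_of_isCartanInt_two (hα : α ∈ nzRealRoots (fun u v => B u v) R)
    (hβ : β ∈ nzRealRoots (fun u v => B u v) R) (hm : IsCartanInt (fun u v => B u v) β α 2)
    (hn : IsCartanInt (fun u v => B u v) α β 2) : β = α := by
  have := isAddTorsionFree_of_radical_eq (isBiadditive_bilinForm B) h.nondegenerate
  by_contra hne
  have hα' : α ∈ realRoots (fun u v => B u v) R := Or.inl hα
  have hv : α - β ≠ 0 := sub_ne_zero.mpr (Ne.symm hne)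
  let g : ℕ → V := fun k => (1 + 2 * (k : ℤ)) • α + (-(2 * (k : ℤ))) • β
  have hinj : Function.Injective g := by
    intro k l hkl
    have h0 : (2 * ((k : ℤ) - l)) • (α - β) = 0 := by
      have := sub_eq_zero.mpr hkl
      rw [← this]
      simp only [g]
      module
    have := (smul_eq_zero.mp h0).resolve_right hv
    omega
  refine Set.infinite_of_injective_forall_mem hinj (fun k => ?_)
    (h.finite_realRoots_inter_span_pair hα hβ)
  refine ⟨zsmul_add_zsmul_mem_span_pair α β _ _, ?_⟩
  induction k with
  | zero => simpa [g] using hα'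
  | succ k ih =>
    have c1 := hn.zsmul_add_zsmul (isBiadditive_bilinForm B) (-(2 * (k : ℤ))) (1 + 2 * (k : ℤ))
    rw [add_comm] at c1
    have m1 := h.reflection_mem_realRoots hβ ih c1
    have e1 : g k - (2 * (-(2 * (k : ℤ))) + 2 * (1 + 2 * (k : ℤ))) • β =
        (1 + 2 * (k : ℤ)) • α + (-2 - 2 * (k : ℤ)) • β := by
      simp only [g]
      module
    rw [e1] at m1
    have m2 := h.reflection_mem_realRoots hα m1 (hm.zsmul_add_zsmul (isBiadditive_bilinForm B) _ _)
    convert m2 using 1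
    simp only [g]
    push_cast
    module

/-- A root of positive Cartan integer with `α` can be lowered by `α`. -/
theorem sub_mem_realRoots (hα : α ∈ nzRealRoots (fun u v => B u v) R)
    (hβ : β ∈ nzRealRoots (fun u v => B u v) R) (hm : IsCartanInt (fun u v => B u v) β α m)
    (h1 : 1 ≤ m) : β - α ∈ realRoots (fun u v => B u v) R := by
  obtain ⟨n, hn, -⟩ := h.exists_isCartanInt hβ hα.1
  obtain ⟨hmn0, hmn4⟩ := h.mul_isCartanInt_mem_Icc hα hβ hm hn
  have hn0 := hm.eq_zero_iff (h.symm α β) hα.2 hβ.2 hn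
  have hn1 : 1 ≤ n := by
    have : 0 ≤ n := nonneg_of_mul_nonneg_right hmn0 (by omega)
    omega
  rcases h1.eq_or_lt with rfl | hm2
  · simpa using h.reflection_mem_realRoots hα (Or.inl hβ) hm
  rcases hn1.eq_or_lt with rfl | hn2
  · have hr : α - β ∈ realRoots (fun u v => B u v) R := by
      simpa using h.reflection_mem_realRoots hβ (Or.inl hα) hn
    -- `β - α` is the image of `α - β` under its own reflection
    rcases hr with hr | hr
    · have := h.reflection_mem_realRoots hr (Or.inl hr) (IsCartanInt.self _)
      convert this using 1
      module
    · exact Or.inr (by rw [← neg_sub, Set.mem_singleton_iff.mp hr]; simp)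
  · obtain rfl : m = 2 := by nlinarith
    obtain rfl : n = 2 := by nlinarith
    exact Or.inr (sub_eq_zero.mpr (h.eq_of_isCartanInt_two hα hβ hm hn))

/-- Root strings of real roots are unbroken: the exponents form a finite set of integers, symmetric
under `k ↦ -m - k`, and closed under steps towards its centre. -/
theorem exists_string (hα : α ∈ nzRealRoots (fun u v => B u v) R)
    (hβ : β ∈ nzRealRoots (fun u v => B u v) R) :
    ∃ p q : ℕ, 2 * B β α / B α α = (p : F) - (q : F) ∧
      ∀ k : ℤ, β + k • α ∈ realRoots (fun u v => B u v) R ↔ -(p : ℤ) ≤ k ∧ k ≤ q := by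
  have := isAddTorsionFree_of_radical_eq (isBiadditive_bilinForm B) h.nondegenerate
  obtain ⟨m, hm, -⟩ := h.exists_isCartanInt hα hβ.1
  have hα0 : α ≠ 0 := by
    rintro rfl
    exact hα.2 (by simp)
  set K : Set ℤ := {k | β + k • α ∈ realRoots (fun u v => B u v) R}
  have hcartan : ∀ k : ℤ, IsCartanInt (fun u v => B u v) (β + k • α) α (m + 2 * k) := by
    intro k
    have := hm.zsmul_add_zsmul (isBiadditive_bilinForm B) k 1
    rwa [one_smul, add_comm (k • α), mul_one, add_comm (2 * k)] at this
  have hsymm : ∀ k ∈ K, -m - k ∈ K := by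
    intro k hk
    have := h.reflection_mem_realRoots hα hk (hcartan k)
    change β + (-m - k) • α ∈ realRoots (fun u v => B u v) R
    convert this using 1
    module
  have hstep : ∀ k ∈ K, 1 ≤ m + 2 * k → k - 1 ∈ K := by
    intro k hk h1
    have hne : β + k • α ≠ 0 := by
      intro h0
      have := (hcartan k).unique hα.2 (n := 0) (by simp [IsCartanInt, h0])
      omega
    have := h.sub_mem_realRoots hα (mem_nzRealRoots_of_mem_realRoots hk hne) (hcartan k) h1
    change β + (k - 1) • α ∈ realRoots (fun u v => B u v) R
    convert this using 1
    module
  have hfin : K.Finite := by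
    have hinj : Function.Injective fun k : ℤ => β + k • α :=
      (add_right_injective β).comp (smul_left_injective ℤ hα0)
    refine ((h.finite_realRoots_inter_span_pair hα hβ).preimage hinj.injOn).subset
      fun k hk => ⟨?_, hk⟩
    have := zsmul_add_zsmul_mem_span_pair (F := F) α β k 1
    rwa [one_smul, add_comm] at this
  have h0K : (0 : ℤ) ∈ K := by
    change β + (0 : ℤ) • α ∈ realRoots (fun u v => B u v) R
    rw [zero_smul, add_zero]
    exact Or.inl hβ
  obtain ⟨q, hq, hmax⟩ := Set.exists_max_image K id hfin ⟨0, h0K⟩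
  simp only [id] at hmax
  have hq0 := hmax 0 h0K
  have hp0 := hmax _ (hsymm 0 h0K)
  have hdown : ∀ j : ℕ, -1 ≤ m + 2 * (q - j) → q - j ∈ K := by
    intro j
    induction j with
    | zero => intro _; simpa using hq
    | succ j ih =>
      intro hj
      push_cast at hj ⊢
      have := hstep _ (ih (by omega)) (by omega)
      rwa [sub_sub] at this
  have hupper : ∀ k, k ≤ q → -1 ≤ m + 2 * k → k ∈ K := by
    intro k hkq hk
    have := hdown (q - k).toNat
    rw [Int.toNat_of_nonneg (by omega), sub_sub_cancel] at this
    exact this hk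
  refine ⟨(m + q).toNat, q.toNat, ?_, fun k => ?_⟩
  · rw [div_eq_iff hα.2]
    have hpq : m = ((m + q).toNat : ℤ) - (q.toNat : ℤ) := by omega
    have hpq' : (m : F) = ((m + q).toNat : F) - (q.toNat : F) := by
      exact_mod_cast congrArg (Int.cast : ℤ → F) hpq
    rw [← hpq']
    exact hm
  · rw [Int.toNat_of_nonneg (by omega), Int.toNat_of_nonneg hq0]
    constructor
    · intro hk
      have h1 := hmax k hk
      have h2 := hmax _ (hsymm k hk)
      omega
    · rintro ⟨h1, h2⟩
      rcases le_or_gt 0 (m + 2 * k) with hk | hk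
      · exact hupper k h2 (by omega)
      · have := hsymm _ (hupper (-m - k) (by omega) (by omega))
        rwa [sub_sub_cancel] at this

/-! ### The lattice spanned by the roots -/

theorem satisfiesS : SatisfiesS (fun a b : AddSubgroup.closure R => B (a : V) (b : V))
    {a : AddSubgroup.closure R | (a : V) ∈ R} where
  s1 := ⟨h.zero_mem, AddSubgroup.closure_closure_coe_preimage⟩
  s2 := by
    ext a
    change (a : V) ∈ R ↔ -(a : V) ∈ R
    exact Set.ext_iff.mp h.neg_eq a
  s3 := by
    intro α hα β hβ
    obtain ⟨m, hm, hmem⟩ := h.exists_isCartanInt (α := (α : V)) hα hβ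
    refine ⟨m, ?_, hmem⟩
    rw [div_eq_iff hα.2]
    exact (congrArg (2 * ·) (h.symm α β)).trans hm
  s4 := by
    intro α hα β hβ
    obtain ⟨p, q, hpq, hstr⟩ := h.exists_string (α := (α : V)) (β := (β : V)) hα hβ
    refine ⟨p, q, hpq, ?_⟩
    have hiff : ∀ a : AddSubgroup.closure R,
        a ∈ realRoots (fun a b : AddSubgroup.closure R => B (a : V) (b : V))
          {a : AddSubgroup.closure R | (a : V) ∈ R} ↔
        (a : V) ∈ realRoots (fun u v => B u v) R :=
      fun a => or_congr Iff.rfl Subtype.ext_iff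
    ext a
    constructor
    · rintro ⟨⟨k, rfl⟩, hk⟩
      have := (hstr k).mp ((hiff _).mp hk)
      exact ⟨k, this.1, this.2, rfl⟩
    · rintro ⟨k, h1, h2, rfl⟩
      exact ⟨⟨k, rfl⟩, (hiff _).mpr ((hstr k).mpr ⟨h1, h2⟩)⟩
  s5 := fun α hα β hβ hne => h.nonsingular α hα β hβ hne

end IsLocallyFiniteRootSupersystem

end Supersystem

end RootSuper

theorem lemma3p21 {F : Type*} [Field F] [CharZero F] :
    -- from subsets of abelian groups to root supersystems
    (∀ {A : Type*} [AddCommGroup A] (f : A → A → F) (hf : RootSuper.IsBiadditive f),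
      RootSuper.IsSymmetric f → RootSuper.radical f = {0} →
      ∀ R : Set A, RootSuper.SatisfiesS f R →
        IsAddTorsionFree A ∧
        RootSuper.IsLocallyFiniteRootSupersystem (RootSuper.extendForm f hf)
          ((fun a : A => (1 : F) ⊗ₜ[ℤ] a) '' R)) ∧
    -- from root supersystems to subsets of abelian groups, with `A = span_ℤ R`
    (∀ {V : Type*} [AddCommGroup V] [Module F V] (B : LinearMap.BilinForm F V) (R : Set V),
      RootSuper.IsLocallyFiniteRootSupersystem B R →
        IsAddTorsionFree (AddSubgroup.closure R) ∧
        RootSuper.IsBiadditive (fun a b : AddSubgroup.closure R => B (a : V) (b : V)) ∧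
        RootSuper.IsSymmetric (fun a b : AddSubgroup.closure R => B (a : V) (b : V)) ∧
        RootSuper.radical (fun a b : AddSubgroup.closure R => B (a : V) (b : V)) = {0} ∧
        RootSuper.SatisfiesS (fun a b : AddSubgroup.closure R => B (a : V) (b : V))
          {a : AddSubgroup.closure R | (a : V) ∈ R}) := by
  refine ⟨fun f hf hs hrad R h => ⟨RootSuper.isAddTorsionFree_of_radical_eq hf hrad,
    h.isLocallyFiniteRootSupersystem hf hs hrad⟩, fun {V} _ _ B R h => ?_⟩
  have hbi : RootSuper.IsBiadditive (fun a b : AddSubgroup.closure R => B (a : V) (b : V)) :=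
    ⟨fun a b c => (RootSuper.isBiadditive_bilinForm B).1 a b c,
      fun a b c => (RootSuper.isBiadditive_bilinForm B).2 a b c⟩
  exact ⟨RootSuper.isAddTorsionFree_of_radical_eq hbi h.radical_restrict, hbi,
    fun a b => h.symm a b, h.radical_restrict, h.satisfiesS⟩
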